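/- Fix $T\ge 1$ stages. In stage $t$ the buyer's type $v_t\in\mathcal V_t=\mathbb R_+^{k_t}$ is drawn from a distribution $\mathcal F_t$ with finite mean, independently across stages. Let $\mathcal H_t=\mathcal V_1\times\dots\times\mathcal V_t$ be the set of histories of length $t$ ($\mathcal H_0$ is a point), and let $g_t:\mathcal H_t\to\mathbb R$ ($0\le t\le T$) and $y_t:\mathcal H_t\to\mathbb R^{k_t}$ ($1\le t\le T$) be arbitrary functions. A bank account mechanism consists, for each $t$, of an allocation rule $z_t:\mathbb R_+\times\mathcal V_t\to[0,1]^{k_t}$, a payment rule $q_t:\mathbb R_+\times\mathcal V_t\to\mathbb R_+$, a deposit policy $d_t:\mathbb R_+\times\mathcal V_t\to\mathbb R_+$ and a spend policy $s_t:\mathbb R_+\to\mathbb R$ with $s_t(b)\le b$. Its balances $\mathsf{bal}_t:\mathcal H_{t-1}\to\mathbb R_+$ are given by $\mathsf{bal}_1=0$ and $\mathsf{bal}_{t+1}=\mathsf{bal}_t-s_t(\mathsf{bal}_t)+d_t(\mathsf{bal}_t,v_t)$. Write $\hat u_t(b,v';v)=z_t(b,v')\cdot v-q_t(b,v')$. The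 mechanism satisfies the IC constraints if, for all $t$, all $b,b'\ge 0$ and all $v,v'\in\mathcal V_t$, $\hat u_t(b,v;v)\ge\hat u_t(b,v';v)$ and $s_t(b)-s_t(b')=\mathbb E_{v_t}[\hat u_t(b,v_t;v_t)-\hat u_t(b',v_t;v_t)]$. It satisfies the IR constraint if $\hat u_t(b,v;v)\ge d_t(b,v)$ for all $t,b,v$. The construction $B^{g,y}$ is defined by $$\mathsf{bal}_{t+1}(v_{(1,t)})=g_t(v_{(1,t)})-\mu_t\ (0\le t\le T),\qquad z_t(\mathsf{bal}_t(v_{(1,t-1)}),v_t)=y_t(v_{(1,t)}),$$ $$q_t(b,v_t)=z_t(b,v_t)\cdot v_t-\int_{\mathbf 0}^{v_t}z_t(b,v)\cdot\mathrm dv,\quad d_t(b,v_t)=\hat u_t(b,v_t;v_t),\quad s_t(\mathsf{bal}_t)=\mathsf{bal}_t+d_t(\mathsf{bal}_t,v_t)-\mathsf{bal}_{t+1},$$ where $\mu_t=\inf g_t$ for $t<T$, $\mu_T=\min\{0,\inf g_T\}$, and the path integral is taken along the segment from $\mathbf 0$ to $v_t$. We call $B^{g,y}$ a core BAM if these equations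 define a bank account mechanism (that is, are satisfied by some bank account mechanism) which satisfies the IC and IR constraints. **Theorem.** $B^{g,y}$ is a core BAM if and only if, for every $t\in\{1,\dots,T\}$: 1. $y_t$ is the sub-gradient $\partial g_t/\partial v_t$ of $g_t$ with respect to $v_t$, with values in $[0,1]^{k_t}$. That is, for every $h\in\mathcal H_{t-1}$ and $v,w\in\mathcal V_t$, $g_t(h,w)\ge g_t(h,v)+y_t(h,v)\cdot(w-v)$, and the choice of the sub-gradient at points of non-differentiability is determined by the function being differentiated: if $g_t(h,\cdot)=g_t(h',\cdot)$ as functions on $\mathcal V_t$, then $y_t(h,\cdot)=y_t(h',\cdot)$. 2. $g_t$ is consistent ($\mathbb E_{v_t}[g_t(h,v_t)]$ exists for all $h\in\mathcal H_{t-1}$, and $g_{t-1}(h)-\mathbb E_{v_t}[g_t(h,v_t)]$ is a constant $c_t$ not depending on $h$), symmetric (if $g_{t-1}(h)=g_{t-1}(h')$ then $g_t(h,v)=g_t(h',v)$ for all $v\in\mathcal V_t$), convex in $v_t$ and weakly increasing in $v_t$. -/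

import Mathlib

open MeasureTheory
open scoped NNReal BigOperators

/-! Stages are indexed by `t = 0, 1, 2, …`; a `T`-stage problem uses exactly the stages `t < T`,
and `t < T` here is the stage usually called `t + 1`.  Data at other indices are irrelevant:
no definition below that takes `T` looks at them. -/

/-- The type space `ℝ₊^{k_t}` of stage `t`. -/
abbrev StageType (k : ℕ → ℕ) (t : ℕ) : Type := Fin (k t) → ℝ≥0

/-- The set of stage allocations `[0,1]^{k_t}`. -/
abbrev StageAlloc (k : ℕ → ℕ) (t : ℕ) : Type := Fin (k t) → unitInterval

/-- Histories of length `t`: the product of the type spaces of the first `t` stages. -/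
def History (k : ℕ → ℕ) : ℕ → Type
  | 0 => Unit
  | t + 1 => History k t × StageType k t

/-- The history `h` followed by the type `v`. -/
def History.snoc {k : ℕ → ℕ} {t : ℕ} (h : History k t) (v : StageType k t) : History k (t + 1) :=
  (h, v)

/-- The pairing `x · v = ∑ᵢ xᵢ vᵢ` of an allocation with a type. -/
def payoff {n : ℕ} (x : Fin n → ℝ) (v : Fin n → ℝ≥0) : ℝ := ∑ i, x i * (v i : ℝ)

/-- A bank account mechanism: allocation rule `z`, payment rule `q`, deposit policy `d` and spend
policy `s`.  The balance functions are derived from `d` and `s` below. -/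
structure BankAccountMechanism (k : ℕ → ℕ) where
  /-- allocation, as a function of balance and reported stage type -/
  z : (t : ℕ) → ℝ≥0 → StageType k t → StageAlloc k t
  /-- payment, as a function of balance and reported stage type -/
  q : (t : ℕ) → ℝ≥0 → StageType k t → ℝ≥0
  /-- deposit, as a function of balance and reported stage type -/
  d : (t : ℕ) → ℝ≥0 → StageType k t → ℝ≥0
  /-- spend, as a function of the balance -/
  s : ℕ → ℝ≥0 → ℝ
  /-- one never spends more than the balance -/
  s_le : ∀ (t : ℕ) (b : ℝ≥0), s t b ≤ b

/-- The allocation `z_t(b, v)` as a real vector. -/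
def BankAccountMechanism.alloc {k : ℕ → ℕ} (B : BankAccountMechanism k) (t : ℕ) (b : ℝ≥0)
    (v : StageType k t) : Fin (k t) → ℝ :=
  fun i => (B.z t b v i : ℝ)

/-- The balance after `t` stages with reports `h`: it starts at `0`, and each stage subtracts the
spend and adds the deposit. -/
def BankAccountMechanism.bal {k : ℕ → ℕ} (B : BankAccountMechanism k) :
    (t : ℕ) → History k t → ℝ≥0
  | 0, _ => 0
  | t + 1, (h, v) =>
    ⟨(B.bal t h : ℝ) - B.s t (B.bal t h) + B.d t (B.bal t h) v,
      add_nonneg (sub_nonneg.2 (B.s_le t (B.bal t h))) (B.d t (B.bal t h) v).2⟩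

/-- Stage utility `z_t(b, v') · v - q_t(b, v')` at balance `b`, report `v'` and true type `v`. -/
def BankAccountMechanism.stageUtil {k : ℕ → ℕ} (B : BankAccountMechanism k) (t : ℕ) (b : ℝ≥0)
    (v' v : StageType k t) : ℝ :=
  payoff (B.alloc t b v') v - B.q t b v'

/-- The IC constraints: at every balance the stage mechanism is truthful, and the difference of the
spends at two balances is the difference of the expected truthful stage utilities. -/
def BankAccountMechanism.IsIC {k : ℕ → ℕ} (B : BankAccountMechanism k) (T : ℕ)
    (F : (t : ℕ) → Measure (StageType k t)) : Prop :=
  ∀ t < T,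
    (∀ (b : ℝ≥0) (v v' : StageType k t), B.stageUtil t b v' v ≤ B.stageUtil t b v v) ∧
    (∀ b : ℝ≥0, Integrable (fun v => B.stageUtil t b v v) (F t)) ∧
    (∀ b b' : ℝ≥0,
      B.s t b - B.s t b' = ∫ v, (B.stageUtil t b v v - B.stageUtil t b' v v) ∂(F t))

/-- The IR constraint: the deposit never exceeds the truthful stage utility. -/
def BankAccountMechanism.IsIR {k : ℕ → ℕ} (B : BankAccountMechanism k) (T : ℕ) : Prop :=
  ∀ t < T, ∀ (b : ℝ≥0) (v : StageType k t), (B.d t b v : ℝ) ≤ B.stageUtil t b v v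

/-- The shift `μ_t`: the infimum of `g_t` for `t < T`, and `min {0, inf g_T}` for `t = T`. -/
noncomputable def shift {k : ℕ → ℕ} (T : ℕ) (g : (t : ℕ) → History k t → ℝ) (t : ℕ) : ℝ :=
  if t < T then ⨅ h, g t h else min 0 (⨅ h, g t h)

/-- The integrand of the path integral of `x` along the segment `r ↦ r v`, `0 ≤ r ≤ 1`. -/
noncomputable def segmentIntegrand {n : ℕ} (x : (Fin n → ℝ≥0) → Fin n → ℝ) (v : Fin n → ℝ≥0)
    (r : ℝ) : ℝ :=
  payoff (x (r.toNNReal • v)) v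

/-- `B` is the mechanism constructed from `g` and `y`. The path integral in the payment rule is
taken along the straight segment from `0` to `v`. -/
structure BankAccountMechanism.IsConstruction {k : ℕ → ℕ} (B : BankAccountMechanism k) (T : ℕ)
    (g : (t : ℕ) → History k t → ℝ) (y : (t : ℕ) → History k (t + 1) → Fin (k t) → ℝ) : Prop where
  /-- the infima in the shifts are finite -/
  bddBelow : ∀ t ≤ T, BddBelow (Set.range (g t))
  /-- balance -/
  balance : ∀ t ≤ T, ∀ h : History k t, (B.bal t h : ℝ) = g t h - shift T g t
  /-- allocation -/
  allocation : ∀ t < T, ∀ (h : History k t) (v : StageType k t),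
    B.alloc t (B.bal t h) v = y t (h.snoc v)
  /-- the path integral in the payment rule exists -/
  integrable : ∀ t < T, ∀ (b : ℝ≥0) (v : StageType k t),
    IntervalIntegrable (segmentIntegrand (B.alloc t b) v) volume 0 1
  /-- payment -/
  payment : ∀ t < T, ∀ (b : ℝ≥0) (v : StageType k t),
    (B.q t b v : ℝ)
      = payoff (B.alloc t b v) v - ∫ r in (0 : ℝ)..1, segmentIntegrand (B.alloc t b) v r
  /-- deposit -/
  deposit : ∀ t < T, ∀ (b : ℝ≥0) (v : StageType k t), (B.d t b v : ℝ) = B.stageUtil t b v v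
  /-- spend -/
  spend : ∀ t < T, ∀ (h : History k t) (v : StageType k t),
    B.s t (B.bal t h) = B.bal t h + B.d t (B.bal t h) v - B.bal (t + 1) (h.snoc v)

/-- The construction from `g` and `y` is a core BAM: its defining equations define a bank account
mechanism, and this mechanism satisfies the IC and IR constraints. -/
def IsCoreBAM {k : ℕ → ℕ} (T : ℕ) (F : (t : ℕ) → Measure (StageType k t))
    (g : (t : ℕ) → History k t → ℝ) (y : (t : ℕ) → History k (t + 1) → Fin (k t) → ℝ) : Prop :=
  ∃ B : BankAccountMechanism k, B.IsConstruction T g y ∧ B.IsIC T F ∧ B.IsIR T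

/-- `y_t` is the sub-gradient `∂g_t / ∂v_t` on `ℝ₊^{k_t}`. Where `g_t` is not differentiable, some
choice of a sub-gradient is made; it is determined by the function `g_t(h, ·)`. -/
def IsSubgradientAt {k : ℕ → ℕ} (g : (t : ℕ) → History k t → ℝ)
    (y : (t : ℕ) → History k (t + 1) → Fin (k t) → ℝ) (t : ℕ) : Prop :=
  (∀ (h : History k t) (v w : StageType k t),
    g (t + 1) (h.snoc v) + ∑ i, y t (h.snoc v) i * ((w i : ℝ) - v i) ≤ g (t + 1) (h.snoc w)) ∧
  (∀ h h' : History k t, (∀ v : StageType k t, g (t + 1) (h.snoc v) = g (t + 1) (h'.snoc v)) →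
    ∀ v : StageType k t, y t (h.snoc v) = y t (h'.snoc v))

/-- `g_{t-1} - E[g_t]` (expectation over the stage type) is constant. -/
def IsConsistentAt {k : ℕ → ℕ} (F : (t : ℕ) → Measure (StageType k t))
    (g : (t : ℕ) → History k t → ℝ) (t : ℕ) : Prop :=
  (∀ h : History k t, Integrable (fun v => g (t + 1) (h.snoc v)) (F t)) ∧
  ∃ c : ℝ, ∀ h : History k t, g t h - ∫ v, g (t + 1) (h.snoc v) ∂(F t) = c

/-- Two histories with equal values of `g_{t-1}` give equal values of `g_t` for each next type. -/
def IsSymmetricAt {k : ℕ → ℕ} (g : (t : ℕ) → History k t → ℝ) (t : ℕ) : Prop :=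
  ∀ h h' : History k t, g t h = g t h' →
    ∀ v : StageType k t, g (t + 1) (h.snoc v) = g (t + 1) (h'.snoc v)

/-! In a construction the balance is `g t` minus a constant, so two histories share a balance
exactly when they share the value of `g t`, and the spend equation makes `g (t + 1)` the truthful
stage utility plus a function of the balance (`eq_stageUtil`). Symmetry is then immediate,
truthfulness is the sub-gradient inequality, and the spend identity in IC is consistency. Convexity
and monotonicity follow from having sub-gradients in `[0,1]`.

Conversely, symmetry and the rule fixing the sub-gradient choice make the allocation and the utility
increment functions of the balance. Setting the spend to a constant plus the expected utility gives
the IC spend identity at once; consistency identifies this spend at reached balances and yields the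
balance equation by induction. The payment formula holds because a sub-gradient integrates along a
segment to the increment of the function. What remains is that spends never exceed balances, which
rests on the shifts being finite lower bounds. -/

section Subgradient

/-! ### Functions on the orthant with a sub-gradient at every point. -/

variable {n : ℕ}

/-- `x v` is a sub-gradient of `u` at every `v`. -/
def IsSubgradientField (u : (Fin n → ℝ≥0) → ℝ) (x : (Fin n → ℝ≥0) → Fin n → ℝ) : Prop :=
  ∀ v w, u v + ∑ i, x v i * ((w i : ℝ) - v i) ≤ u w

theorem sum_mul_sub_eq_payoff (a : Fin n → ℝ) (v w : Fin n → ℝ≥0) :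
    ∑ i, a i * ((w i : ℝ) - v i) = payoff a w - payoff a v := by
  simp only [payoff, mul_sub, Finset.sum_sub_distrib]

theorem payoff_zero_right (a : Fin n → ℝ) : payoff a 0 = 0 := by simp [payoff]

theorem payoff_smul (a : Fin n → ℝ) (r : ℝ≥0) (v : Fin n → ℝ≥0) :
    payoff a (r • v) = r * payoff a v := by
  simp only [payoff, Finset.mul_sum, Pi.smul_apply, smul_eq_mul, NNReal.coe_mul]
  exact Finset.sum_congr rfl fun i _ => by ring

theorem payoff_add (a : Fin n → ℝ) (v w : Fin n → ℝ≥0) :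
    payoff a (v + w) = payoff a v + payoff a w := by
  simp only [payoff, ← Finset.sum_add_distrib, Pi.add_apply, NNReal.coe_add, mul_add]

variable {u : (Fin n → ℝ≥0) → ℝ} {x : (Fin n → ℝ≥0) → Fin n → ℝ}

theorem IsSubgradientField.le (h : IsSubgradientField u x) (v w : Fin n → ℝ≥0) :
    u v + (payoff (x v) w - payoff (x v) v) ≤ u w := by
  rw [← sum_mul_sub_eq_payoff]; exact h v w

theorem IsSubgradientField.monotone (h : IsSubgradientField u x) (hx : ∀ v i, 0 ≤ x v i) :
    Monotone u := fun v w hvw => by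
  have : 0 ≤ ∑ i, x v i * ((w i : ℝ) - v i) :=
    Finset.sum_nonneg fun i _ => mul_nonneg (hx v i) (sub_nonneg.2 (NNReal.coe_le_coe.2 (hvw i)))
  linarith [h v w]

/-- Average the sub-gradient inequalities at the mixed point, tested at the two endpoints. -/
theorem IsSubgradientField.convexOn (h : IsSubgradientField u x) :
    ConvexOn ℝ≥0 Set.univ u := by
  refine ⟨convex_univ, fun v _ w _ a b _ _ hab => ?_⟩
  have hv := h.le (a • v + b • w) v
  have hw := h.le (a • v + b • w) w
  set p := x (a • v + b • w)
  rw [payoff_add, payoff_smul, payoff_smul] at hv hw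
  have hab' : (a : ℝ) + b = 1 := by exact_mod_cast hab
  have h1 := mul_le_mul_of_nonneg_left hv a.2
  have h2 := mul_le_mul_of_nonneg_left hw b.2
  simp only [NNReal.smul_def, smul_eq_mul]
  have hb : (b : ℝ) = 1 - a := by linarith
  simp only [NNReal.val_eq_coe, hb] at *
  nlinarith

theorem IsSubgradientField.le_add_sum (h : IsSubgradientField u x) (hx : ∀ v i, x v i ≤ 1)
    (v : Fin n → ℝ≥0) : u v ≤ u 0 + ∑ i, (v i : ℝ) := by
  have h0 := h.le v 0
  rw [payoff_zero_right] at h0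
  have : payoff (x v) v ≤ ∑ i, (v i : ℝ) :=
    Finset.sum_le_sum fun i _ => mul_le_of_le_one_left (v i).2 (hx v i)
  linarith

theorem IsSubgradientField.sub_const (h : IsSubgradientField u x) (c : ℝ) :
    IsSubgradientField (fun v => u v - c) x := fun v w => by
  linarith [h v w]

/-- A monotone sub-gradient of a function on `[0, 1]` integrates to the increment. -/
theorem integral_eq_sub_of_monotone_subgradient {φ ψ : ℝ → ℝ} (hψ : Monotone ψ)
    (h : ∀ r ∈ Set.Icc (0 : ℝ) 1, ∀ s ∈ Set.Icc (0 : ℝ) 1, φ r + ψ r * (s - r) ≤ φ s) :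
    ∫ r in (0 : ℝ)..1, ψ r = φ 1 - φ 0 := by
  -- The slopes are bounded by monotonicity, so `φ` is Lipschitz.
  have hcont : ContinuousOn φ (Set.Icc 0 1) := by
    have hM : ∀ r ∈ Set.Icc (0 : ℝ) 1, |ψ r| ≤ |ψ 0| + |ψ 1| := fun r hr =>
      abs_le.2 ⟨by linarith [hψ hr.1, neg_abs_le (ψ 0), abs_nonneg (ψ 1)],
        by linarith [hψ hr.2, le_abs_self (ψ 1), abs_nonneg (ψ 0)]⟩
    refine (LipschitzOnWith.of_dist_le_mul (K := (|ψ 0| + |ψ 1|).toNNReal)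
      fun r hr s hs => ?_).continuousOn
    have hbound : ∀ r ∈ Set.Icc (0 : ℝ) 1, ∀ s : ℝ, |ψ r * (s - r)| ≤ (|ψ 0| + |ψ 1|) * |r - s| :=
      fun r hr s => by
        rw [abs_mul, abs_sub_comm s r]
        exact mul_le_mul_of_nonneg_right (hM r hr) (abs_nonneg _)
    have h1 := h r hr s hs
    have h2 := h s hs r hr
    have h3 := abs_le.1 (hbound r hr s)
    have h4 := abs_le.1 (hbound s hs r)
    rw [abs_sub_comm s r] at h4
    rw [Real.dist_eq, Real.dist_eq, Real.coe_toNNReal _ (by positivity)]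
    exact abs_le.2 ⟨by linarith, by linarith⟩
  -- A monotone `ψ` has countably many discontinuities. Elsewhere `φ' = ψ`, since `0 ≤ φ s - φ r -
  -- (s - r) ψ r ≤ (ψ s - ψ r)(s - r)`.
  refine integral_eq_of_hasDerivAt_off_countable φ ψ hψ.countable_not_continuousAt
    (by rwa [Set.uIcc_of_le zero_le_one]) ?_ hψ.intervalIntegrable
  rintro r ⟨hr, hc⟩
  rw [min_eq_left zero_le_one, max_eq_right zero_le_one] at hr
  have hc : ContinuousAt ψ r := by simpa using hc
  rw [hasDerivAt_iff_isLittleO, Asymptotics.isLittleO_iff]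
  intro ε hε
  filter_upwards [Icc_mem_nhds hr.1 hr.2, Metric.continuousAt_iff'.1 hc ε hε] with s hs hsε
  have h1 := h r ⟨hr.1.le, hr.2.le⟩ s hs
  have h2 := h s hs r ⟨hr.1.le, hr.2.le⟩
  rw [Real.dist_eq] at hsε
  rw [Real.norm_eq_abs, Real.norm_eq_abs, smul_eq_mul, abs_of_nonneg (by linarith)]
  calc φ s - φ r - (s - r) * ψ r ≤ (ψ s - ψ r) * (s - r) := by linarith
    _ ≤ |ψ s - ψ r| * |s - r| := by rw [← abs_mul]; exact le_abs_self _
    _ ≤ ε * |s - r| := mul_le_mul_of_nonneg_right hsε.le (abs_nonneg _)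

theorem IsSubgradientField.along_segment (h : IsSubgradientField u x) (v : Fin n → ℝ≥0) (r s : ℝ) :
    u (r.toNNReal • v) + segmentIntegrand x v r * ((s.toNNReal : ℝ) - r.toNNReal)
      ≤ u (s.toNNReal • v) := by
  have := h.le (r.toNNReal • v) (s.toNNReal • v)
  rw [payoff_smul, payoff_smul] at this
  unfold segmentIntegrand
  linarith

/-- Adding the inequalities from `r` to `s` and back gives monotonicity; `toNNReal` is constant on
negative parameters, so it holds on all of `ℝ`. -/
theorem IsSubgradientField.monotone_segmentIntegrand (h : IsSubgradientField u x)
    (v : Fin n → ℝ≥0) : Monotone (segmentIntegrand x v) := fun r s hrs => by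
  rcases (Real.toNNReal_le_toNNReal hrs).eq_or_lt with heq | hlt
  · simp only [segmentIntegrand, heq, le_refl]
  · have h1 := h.along_segment v r s
    have h2 := h.along_segment v s r
    have h3 : (0 : ℝ) < s.toNNReal - r.toNNReal := sub_pos.2 (NNReal.coe_lt_coe.2 hlt)
    by_contra! hcon
    nlinarith

theorem IsSubgradientField.integral_segmentIntegrand (h : IsSubgradientField u x)
    (v : Fin n → ℝ≥0) : ∫ r in (0 : ℝ)..1, segmentIntegrand x v r = u v - u 0 := by
  have := integral_eq_sub_of_monotone_subgradient (φ := fun r => u (r.toNNReal • v))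
    (h.monotone_segmentIntegrand v) fun r hr s hs => by
      simpa only [Real.coe_toNNReal _ hr.1, Real.coe_toNNReal _ hs.1] using h.along_segment v r s
  simpa using this

end Subgradient

instance History.instNonempty (k : ℕ → ℕ) : (t : ℕ) → Nonempty (History k t)
  | 0 => ⟨()⟩
  | t + 1 => (History.instNonempty k t).map fun h => h.snoc 0

/-! ### From a core BAM to the conditions on `g` and `y`. -/

section Mechanism

variable {k : ℕ → ℕ}

/-- The mechanism with given truthful utilities `u`, allocations `x` (a sub-gradient of `u`) and
spends `s`, in which the whole utility is deposited. -/
def BankAccountMechanism.ofUtility (u : (t : ℕ) → ℝ≥0 → StageType k t → ℝ)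
    (x : (t : ℕ) → ℝ≥0 → StageType k t → Fin (k t) → ℝ) (s : ℕ → ℝ≥0 → ℝ)
    (hu : ∀ t b, u t b 0 = 0) (hx : ∀ t b v i, x t b v i ∈ Set.Icc (0 : ℝ) 1)
    (hux : ∀ t b, IsSubgradientField (u t b) (x t b)) (hs : ∀ t (b : ℝ≥0), s t b ≤ b) :
    BankAccountMechanism k where
  z t b v i := ⟨x t b v i, hx t b v i⟩
  -- Nonnegativity is the sub-gradient inequality at `v` tested at `0`, where the utility vanishes.
  q t b v := ⟨payoff (x t b v) v - u t b v, by
    have := (hux t b).le v 0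
    rw [payoff_zero_right, hu] at this
    linarith⟩
  d t b v := ⟨u t b v, by
    rw [← hu t b]; exact (hux t b).monotone (fun v i => (hx t b v i).1) (zero_le (a := v))⟩
  s := s
  s_le := hs

/-- Truthful utility in a construction is one-stage growth of `g`, up to a function of the
balance. -/
theorem BankAccountMechanism.IsConstruction.eq_stageUtil {B : BankAccountMechanism k} {T : ℕ}
    {g : (t : ℕ) → History k t → ℝ} {y : (t : ℕ) → History k (t + 1) → Fin (k t) → ℝ}
    (hB : B.IsConstruction T g y) {t : ℕ} (ht : t < T) (h : History k t) (v : StageType k t) :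
    g (t + 1) (h.snoc v) = B.stageUtil t (B.bal t h) v v +
      (shift T g (t + 1) + B.bal t h - B.s t (B.bal t h)) := by
  have h1 := hB.balance (t + 1) ht (h.snoc v)
  have h2 := hB.spend t ht h v
  rw [hB.deposit t ht] at h2
  linarith

variable {T : ℕ} {F : (t : ℕ) → Measure (StageType k t)} {g : (t : ℕ) → History k t → ℝ}
  {y : (t : ℕ) → History k (t + 1) → Fin (k t) → ℝ}

theorem BankAccountMechanism.IsConstruction.bal_eq_bal_iff {B : BankAccountMechanism k}
    (hB : B.IsConstruction T g y) {t : ℕ} (ht : t < T) {h h' : History k t} :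
    B.bal t h = B.bal t h' ↔ g t h = g t h' := by
  rw [← NNReal.coe_inj, hB.balance t ht.le, hB.balance t ht.le, sub_left_inj]

theorem BankAccountMechanism.IsConstruction.isSubgradientField {B : BankAccountMechanism k}
    (hB : B.IsConstruction T g y) (hIC : B.IsIC T F) {t : ℕ} (ht : t < T) (h : History k t) :
    IsSubgradientField (fun v => g (t + 1) (h.snoc v)) (fun v => y t (h.snoc v)) := fun v w => by
  -- True type `w`, report `v`: the misreport earns the truthful utility at `v` plus `z(v) · (w -
  -- v)`.
  have h1 := (hIC t ht).1 (B.bal t h) w v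
  dsimp only
  rw [← hB.allocation t ht, sum_mul_sub_eq_payoff, hB.eq_stageUtil ht, hB.eq_stageUtil ht]
  unfold BankAccountMechanism.stageUtil at *
  linarith

theorem BankAccountMechanism.IsConstruction.isConsistentAt {B : BankAccountMechanism k}
    (hB : B.IsConstruction T g y) (hIC : B.IsIC T F) {t : ℕ} (ht : t < T)
    [IsProbabilityMeasure (F t)] : IsConsistentAt F g t := by
  obtain ⟨-, hint, hsp⟩ := hIC t ht
  -- By IC, spend minus expected utility is the same at every balance, so it may be evaluated at
  -- balance `0`.
  refine ⟨fun h => ?_, B.s t 0 - (∫ v, B.stageUtil t 0 v v ∂F t) + shift T g t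
    - shift T g (t + 1), fun h => ?_⟩
  · simp only [hB.eq_stageUtil ht]
    exact (hint _).add (integrable_const _)
  · simp only [hB.eq_stageUtil ht]
    rw [integral_add (hint _) (integrable_const _), integral_const, probReal_univ, one_smul]
    have h1 := hsp (B.bal t h) 0
    rw [integral_sub (hint _) (hint _)] at h1
    linarith [hB.balance t ht.le h]

theorem BankAccountMechanism.IsConstruction.isSymmetricAt {B : BankAccountMechanism k}
    (hB : B.IsConstruction T g y) {t : ℕ} (ht : t < T) : IsSymmetricAt g t := fun h h' hg v => by
  rw [hB.eq_stageUtil ht, hB.eq_stageUtil ht, (hB.bal_eq_bal_iff ht).2 hg]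

theorem BankAccountMechanism.IsConstruction.isSubgradientAt {B : BankAccountMechanism k}
    (hB : B.IsConstruction T g y) (hIC : B.IsIC T F) {t : ℕ} (ht : t < T)
    [IsProbabilityMeasure (F t)] : IsSubgradientAt g y t := by
  refine ⟨hB.isSubgradientField hIC ht, fun h h' hg v => ?_⟩
  -- Equal next-stage functions have equal expectations, so consistency gives equal `g t`, hence
  -- equal balances and allocations.
  obtain ⟨-, c, hc⟩ := hB.isConsistentAt hIC ht
  have h1 := hc h
  have h2 := hc h'
  simp only [hg] at h1
  rw [← hB.allocation t ht, ← hB.allocation t ht,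
    (hB.bal_eq_bal_iff ht).2 (by linarith : g t h = g t h')]

/-! ### From the conditions on `g` and `y` to a core BAM. -/

/-- Consistency and the bounds on the sub-gradients bound every `g_t` from below. -/
theorem bddBelow_of_isConsistentAt (hF : ∀ t < T, IsProbabilityMeasure (F t))
    (hmean : ∀ t < T, ∀ i : Fin (k t), Integrable (fun v : StageType k t => (v i : ℝ)) (F t))
    (hsub : ∀ t < T, ∀ h : History k t,
      IsSubgradientField (fun v => g (t + 1) (h.snoc v)) (fun v => y t (h.snoc v)))
    (hy : ∀ t < T, ∀ (h : History k (t + 1)) (i : Fin (k t)), y t h i ∈ Set.Icc (0 : ℝ) 1)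
    (hcons : ∀ t < T, IsConsistentAt F g t) :
    ∀ t ≤ T, BddBelow (Set.range (g t)) := by
  intro t
  induction t with
  | zero => exact fun _ => ⟨g 0 (), by rintro _ ⟨⟨⟩, rfl⟩; exact le_rfl⟩
  | succ t ih =>
    intro ht
    have := hF t ht
    obtain ⟨m, hm⟩ := ih (Nat.le_of_succ_le ht)
    obtain ⟨hint, c, hc⟩ := hcons t ht
    have hsum : Integrable (fun v : StageType k t => ∑ i, (v i : ℝ)) (F t) :=
      integrable_finsetSum _ fun i _ => hmean t ht i
    -- Slopes at most `1` give `E[g (t + 1)] ≤ g (t + 1) (h, 0) + E[∑ vᵢ]`, and consistency says the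
    -- left side is `g t h - c ≥ m - c`.
    refine ⟨m - c - ∫ v, ∑ i, (v i : ℝ) ∂F t, ?_⟩
    rintro _ ⟨⟨h, v⟩, rfl⟩
    have h1 : g (t + 1) (h.snoc 0) ≤ g (t + 1) (h.snoc v) :=
      (hsub t ht h).monotone (fun w i => (hy t ht (h.snoc w) i).1) (zero_le (a := v))
    have h2 : ∫ w, g (t + 1) (h.snoc w) ∂F t
        ≤ ∫ w, (g (t + 1) (h.snoc 0) + ∑ i, (w i : ℝ)) ∂F t :=
      integral_mono (hint h) ((integrable_const _).add hsum)
        fun w => (hsub t ht h).le_add_sum (fun w i => (hy t ht (h.snoc w) i).2) w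
    rw [integral_add (integrable_const _) hsum, integral_const, probReal_univ, one_smul] at h2
    change _ ≤ g (t + 1) (h.snoc v)
    linarith [hc h, hm ⟨h, rfl⟩]

theorem shift_le (hbdd : ∀ t ≤ T, BddBelow (Set.range (g t))) {t : ℕ} (ht : t ≤ T)
    (h : History k t) : shift T g t ≤ g t h := by
  unfold shift
  split_ifs
  · exact ciInf_le (hbdd t ht) h
  · exact (min_le_right _ _).trans (ciInf_le (hbdd t ht) h)

open Classical in
/-- The allocation at each balance: `y` after a history with that balance, and `0` if there is no
such history. -/
noncomputable def allocAtBalance (T : ℕ) (g : (t : ℕ) → History k t → ℝ)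
    (y : (t : ℕ) → History k (t + 1) → Fin (k t) → ℝ) (t : ℕ) (b : ℝ≥0) (v : StageType k t) :
    Fin (k t) → ℝ :=
  if hb : t < T ∧ ∃ h, g t h - shift T g t = b then y t (hb.2.choose.snoc v) else 0

open Classical in
/-- The utility at each balance: the increment of `g` after a history with that balance, and `0` if
there is no such history. -/
noncomputable def utilAtBalance (T : ℕ) (g : (t : ℕ) → History k t → ℝ) (t : ℕ) (b : ℝ≥0)
    (v : StageType k t) : ℝ :=
  if hb : t < T ∧ ∃ h, g t h - shift T g t = b then
    g (t + 1) (hb.2.choose.snoc v) - g (t + 1) (hb.2.choose.snoc 0) else 0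

/-- Properties required at every balance are checked on one representing history, or on the zero
mechanism at unreached balances. -/
theorem atBalance_cases (T : ℕ) (g : (t : ℕ) → History k t → ℝ)
    (y : (t : ℕ) → History k (t + 1) → Fin (k t) → ℝ) (t : ℕ) (b : ℝ≥0) :
    (t < T ∧ ∃ h, g t h - shift T g t = b ∧ (allocAtBalance T g y t b = fun v => y t (h.snoc v)) ∧
      utilAtBalance T g t b = fun v => g (t + 1) (h.snoc v) - g (t + 1) (h.snoc 0)) ∨
    (allocAtBalance T g y t b = 0 ∧ utilAtBalance T g t b = 0) := by
  by_cases hb : t < T ∧ ∃ h, g t h - shift T g t = b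
  · exact .inl ⟨hb.1, hb.2.choose, hb.2.choose_spec, by ext; simp [allocAtBalance, hb],
      by ext; simp [utilAtBalance, hb]⟩
  · exact .inr ⟨by ext; simp [allocAtBalance, hb], by ext; simp [utilAtBalance, hb]⟩

theorem utilAtBalance_eq (hsym : ∀ t < T, IsSymmetricAt g t) {t : ℕ} (ht : t < T) {b : ℝ≥0}
    {h : History k t} (hb : g t h - shift T g t = b) (v : StageType k t) :
    utilAtBalance T g t b v = g (t + 1) (h.snoc v) - g (t + 1) (h.snoc 0) := by
  have hb' : t < T ∧ ∃ h, g t h - shift T g t = b := ⟨ht, h, hb⟩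
  have hg : g t hb'.2.choose = g t h := sub_left_injective (hb'.2.choose_spec.trans hb.symm)
  rw [utilAtBalance, dif_pos hb', hsym t ht _ _ hg, hsym t ht _ _ hg]

theorem allocAtBalance_eq (hsym : ∀ t < T, IsSymmetricAt g t)
    (hsub : ∀ t < T, IsSubgradientAt g y t) {t : ℕ} (ht : t < T) {b : ℝ≥0}
    {h : History k t} (hb : g t h - shift T g t = b) (v : StageType k t) :
    allocAtBalance T g y t b v = y t (h.snoc v) := by
  have hb' : t < T ∧ ∃ h, g t h - shift T g t = b := ⟨ht, h, hb⟩
  have hg : g t hb'.2.choose = g t h := sub_left_injective (hb'.2.choose_spec.trans hb.symm)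
  rw [allocAtBalance, dif_pos hb', (hsub t ht).2 _ _ (hsym t ht _ _ hg)]

theorem isCoreBAM_of_isSubgradientAt (hT : 1 ≤ T) (hF : ∀ t < T, IsProbabilityMeasure (F t))
    (hmean : ∀ t < T, ∀ i : Fin (k t), Integrable (fun v : StageType k t => (v i : ℝ)) (F t))
    (hsub : ∀ t < T, IsSubgradientAt g y t)
    (hy : ∀ t < T, ∀ (h : History k (t + 1)) (i : Fin (k t)), y t h i ∈ Set.Icc (0 : ℝ) 1)
    (hcons : ∀ t < T, IsConsistentAt F g t) (hsym : ∀ t < T, IsSymmetricAt g t) :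
    IsCoreBAM T F g y := by
  have hbdd := bddBelow_of_isConsistentAt hF hmean (fun t ht => (hsub t ht).1) hy hcons
  choose! hint c hc using hcons
  have hu0 : ∀ t b, utilAtBalance T g t b 0 = 0 := fun t b => by
    rcases atBalance_cases T g y t b with ⟨ht, h, -, -, hu⟩ | ⟨-, hu⟩ <;> simp [hu]
  have hx : ∀ t b v i, allocAtBalance T g y t b v i ∈ Set.Icc (0 : ℝ) 1 := fun t b v i => by
    rcases atBalance_cases T g y t b with ⟨ht, h, -, hx, -⟩ | ⟨hx, -⟩
    · rw [hx]; exact hy t ht _ i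
    · simp [hx]
  have hux : ∀ t b, IsSubgradientField (utilAtBalance T g t b) (allocAtBalance T g y t b) := by
    intro t b
    rcases atBalance_cases T g y t b with ⟨ht, h, -, hx, hu⟩ | ⟨hx, hu⟩
    · rw [hx, hu]; exact IsSubgradientField.sub_const ((hsub t ht).1 h) _
    · rw [hx, hu]; intro v w; simp
  have huint : ∀ t < T, ∀ b, Integrable (utilAtBalance T g t b) (F t) := fun t ht b => by
    have := hF t ht
    rcases atBalance_cases T g y t b with ⟨ht, h, -, -, hu⟩ | ⟨-, hu⟩
    · rw [hu]; exact (hint t ht h).sub (integrable_const _)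
    · rw [hu]; exact integrable_zero _ _ _
  -- The constant that consistency forces on spend minus expected utility at reached balances.
  let C : ℕ → ℝ := fun t => c t - shift T g t + shift T g (t + 1)
  let s : ℕ → ℝ≥0 → ℝ := fun t b =>
    if t < T then C t + ∫ v, utilAtBalance T g t b v ∂F t else 0
  have hs_eq : ∀ t < T, ∀ (h : History k t) (b : ℝ≥0), g t h - shift T g t = b →
      s t b = b - (g (t + 1) (h.snoc 0) - shift T g (t + 1)) := by
    intro t ht h b hb
    have := hF t ht
    simp only [s, if_pos ht, C, utilAtBalance_eq hsym ht hb]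
    rw [integral_sub (hint t ht h) (integrable_const _), integral_const, probReal_univ, one_smul]
    linarith [hc t ht h]
  -- At unreached balances the spend is `C t`, possibly at balance `0`. Since spend is at most
  -- balance at reached balances and utility is nonnegative, `C t` is at most every reached balance,
  -- and these have infimum `0` because `t < T`.
  have hC : ∀ t < T, C t ≤ 0 := by
    intro t ht
    have hle : C t + shift T g t ≤ ⨅ h, g t h := by
      refine le_ciInf fun h => ?_
      obtain ⟨b, hb⟩ : ∃ b : ℝ≥0, g t h - shift T g t = b :=
        ⟨_, (Real.coe_toNNReal _ (sub_nonneg.2 (shift_le hbdd ht.le h))).symm⟩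
      have h1 := hs_eq t ht h b hb
      simp only [s, if_pos ht] at h1
      have h2 : 0 ≤ ∫ v, utilAtBalance T g t b v ∂F t :=
        integral_nonneg fun v => by
          rw [Pi.zero_apply, ← hu0 t b]
          exact (hux t b).monotone (fun v i => (hx t b v i).1) (zero_le (a := v))
      linarith [shift_le hbdd ht (h.snoc 0)]
    have : shift T g t = ⨅ h, g t h := if_pos ht
    linarith
  have hs : ∀ t (b : ℝ≥0), s t b ≤ b := by
    intro t b
    by_cases ht : t < T
    · rcases atBalance_cases T g y t b with ⟨-, h, hb, -, -⟩ | ⟨-, hu⟩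
      · rw [hs_eq t ht h b hb]
        linarith [shift_le hbdd ht (h.snoc 0)]
      · simp only [s, if_pos ht, hu, Pi.zero_apply, integral_zero, add_zero]
        exact (hC t ht).trans b.2
    · simp only [s, if_neg ht]; exact b.2
  let B := BankAccountMechanism.ofUtility _ _ s hu0 hx hux hs
  have hutil : ∀ t b (v : StageType k t), B.stageUtil t b v v = utilAtBalance T g t b v := by
    intro t b v
    change payoff _ v - (payoff _ v - utilAtBalance T g t b v) = _
    exact sub_sub_cancel _ _
  have hbal : ∀ t ≤ T, ∀ h : History k t, (B.bal t h : ℝ) = g t h - shift T g t := by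
    intro t
    induction t with
    | zero =>
      rintro - ⟨⟩
      -- `1 ≤ T` excludes the `min` branch of the shift, so the initial balance is exactly `0`.
      have : shift T g 0 = ⨅ h, g 0 h := if_pos hT
      have huniv : (⨅ h, g 0 h) = g 0 () := ciInf_unique (ι := Unit) (s := g 0)
      rw [this, huniv]
      exact (sub_self _).symm
    | succ t ih =>
      rintro ht ⟨h, v⟩
      have hb := (ih (Nat.le_of_succ_le ht) h).symm
      change (B.bal t h : ℝ) - s t (B.bal t h) + utilAtBalance T g t (B.bal t h) v
        = g (t + 1) (h.snoc v) - _
      rw [hs_eq t ht h _ hb, utilAtBalance_eq hsym ht hb]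
      ring
  refine ⟨B, ?_, ?_, ?_⟩
  · exact
    { bddBelow := hbdd
      balance := hbal
      allocation := fun t ht h v => allocAtBalance_eq hsym hsub ht (hbal t ht.le h).symm v
      integrable := fun t _ b v => ((hux t b).monotone_segmentIntegrand v).intervalIntegrable
      payment := fun t _ b v => by
        have := (hux t b).integral_segmentIntegrand v
        rw [hu0, sub_zero] at this
        change payoff (allocAtBalance T g y t b v) v - utilAtBalance T g t b v
          = payoff (allocAtBalance T g y t b v) v
            - ∫ r in (0 : ℝ)..1, segmentIntegrand (allocAtBalance T g y t b) v r
        rw [this]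
      deposit := fun t _ b v => (hutil t b v).symm
      spend := fun t ht h v => by
        have : (B.bal (t + 1) (h.snoc v) : ℝ)
          = B.bal t h - B.s t (B.bal t h) + B.d t (B.bal t h) v := rfl
        linarith }
  · intro t ht
    refine ⟨fun b v v' => ?_, fun b => ?_, fun b b' => ?_⟩
    · rw [hutil]
      change payoff (allocAtBalance T g y t b v') v
        - (payoff (allocAtBalance T g y t b v') v' - utilAtBalance T g t b v') ≤ _
      linarith [(hux t b).le v' v]
    · simp only [hutil]; exact huint t ht b
    · simp only [hutil]
      rw [integral_sub (huint t ht b) (huint t ht b')]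
      change s t b - s t b' = _
      simp only [s, if_pos ht]
      ring
  · exact fun t _ b v => (hutil t b v).symm.le

end Mechanism

theorem theorem2 (T : ℕ) (hT : 1 ≤ T) (k : ℕ → ℕ)
    (F : (t : ℕ) → Measure (StageType k t))
    (hF : ∀ t < T, IsProbabilityMeasure (F t))
    (hmean : ∀ t < T, ∀ i : Fin (k t), Integrable (fun v : StageType k t => (v i : ℝ)) (F t))
    (g : (t : ℕ) → History k t → ℝ)
    (y : (t : ℕ) → History k (t + 1) → Fin (k t) → ℝ) :
    IsCoreBAM T F g y ↔
      ∀ t < T,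
        (IsSubgradientAt g y t ∧
          ∀ (h : History k (t + 1)) (i : Fin (k t)), y t h i ∈ Set.Icc (0 : ℝ) 1) ∧
        (IsConsistentAt F g t ∧ IsSymmetricAt g t ∧
          (∀ h : History k t,
            ConvexOn ℝ≥0 Set.univ (fun v : StageType k t => g (t + 1) (h.snoc v))) ∧
          (∀ h : History k t, Monotone (fun v : StageType k t => g (t + 1) (h.snoc v)))) := by
  constructor
  · rintro ⟨B, hB, hIC, -⟩ t ht
    have := hF t ht
    have hy : ∀ (h : History k (t + 1)) (i : Fin (k t)), y t h i ∈ Set.Icc (0 : ℝ) 1 := by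
      rintro ⟨h, v⟩ i
      change y t (h.snoc v) i ∈ _
      rw [← hB.allocation t ht]
      exact (B.z t (B.bal t h) v i).2
    exact ⟨⟨hB.isSubgradientAt hIC ht, hy⟩, hB.isConsistentAt hIC ht, hB.isSymmetricAt ht,
      fun h => (hB.isSubgradientField hIC ht h).convexOn,
      fun h => (hB.isSubgradientField hIC ht h).monotone fun v i => (hy (h.snoc v) i).1⟩
  · intro H
    exact isCoreBAM_of_isSubgradientAt hT hF hmean (fun t ht => (H t ht).1.1)
      (fun t ht => (H t ht).1.2) (fun t ht => (H t ht).2.1) fun t ht => (H t ht).2.2.1
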